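/- **Setting (restricted Gaussian Y-channel).** Three users $1,2,3$ communicate through a relay over real, reciprocal channels with gains $h_1,h_2,h_3\in\mathbb{R}$ and power $P\ge 0$. Put $C(x)=\frac12\log_2(1+x)$. For a tuple $\vec R=(R_{jk})_{j\neq k}$ of six nonnegative rates, a restricted code of length $n$ consists of the following. The messages $m_{jk}$ (from user $j$ to user $k$, $j\ne k$) are independent and $m_{jk}$ is uniform on the integers $m$ with $1\le m\le 2^{nR_{jk}}$. With restricted encoding, user $j$ sends $x_j^n=f_j\big((m_{jk})_{k\neq j}\big)$, which depends on its own two messages only. At time $i=1,\dots,n$ the relay receives $y_{ri}=h_1x_{1i}+h_2x_{2i}+h_3x_{3i}+z_{ri}$ and sends $x_{ri}=f_{ri}(y_{r1},\dots,y_{r,i-1})$, and user $j$ receives $y_{ji}=h_jx_{ri}+z_{ji}$. All noise samples $z_{ri},z_{1i},z_{2i},z_{3i}$ are standard Gaussian, independent of one another and of the messages. User $j$ estimates the two messages intended for it by $g_j\big(y_j^n,(m_{jk})_{k\ne j}\big)$. The users and the relay obey the power constraint $\frac1n\sum_{i=1}^n\mathbb{E}[X_i^2]\le P$. An error occurs if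 some user estimates one of its two messages wrongly. The tuple $\vec R$ is achievable if there is a sequence of such codes of rate $\vec R$ and length $n$, $n\to\infty$, whose average error probability tends to $0$. The sum-capacity $C_R$ is the supremum of $\sum_{j\neq k}R_{jk}$ over all achievable tuples. **Theorem.** 1. Every achievable $\vec R$ satisfies, for all distinct $j,k,l\in\{1,2,3\}$, $$R_{kj}+R_{lj}+R_{kl}\le C\big((h_k^2+h_l^2)P\big)\quad\text{and}\quad R_{kj}+R_{lj}+R_{kl}\le C\big((h_j^2+h_l^2)P\big).$$ 2. If $h_1^2\ge h_2^2\ge h_3^2$, then $C_R\le 2\,C\big((h_2^2+h_3^2)P\big)$. -/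

import Mathlib

open MeasureTheory ProbabilityTheory Filter Topology

namespace YChannel

noncomputable section

/-- Rates (or any real data) attached to the six ordered pairs of distinct users:
`R j ⟨k, _⟩` is the rate of the message from user `j` to user `k`. Users are `0, 1, 2`. -/
abbrev RateTuple : Type := (j : Fin 3) → {k : Fin 3 // k ≠ j} → ℝ

/-- The sum of all six rates. -/
def sumRate (R : RateTuple) : ℝ := ∑ j, ∑ k, R j k

/-- The number of messages `m` with `1 ≤ m ≤ 2 ^ (n r)`. -/
def msgCount (n : ℕ) (r : ℝ) : ℕ := ⌊(2 : ℝ) ^ ((n : ℝ) * r)⌋₊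

/-- The pair of messages that user `j` sends. -/
abbrev Own (R : RateTuple) (n : ℕ) (j : Fin 3) : Type :=
  (k : {k : Fin 3 // k ≠ j}) → Fin (msgCount n (R j k))

/-- All six messages. -/
abbrev Messages (R : RateTuple) (n : ℕ) : Type := (j : Fin 3) → Own R n j

/-- The pair of messages that are intended for user `j`. -/
abbrev Wanted (R : RateTuple) (n : ℕ) (j : Fin 3) : Type :=
  (k : {k : Fin 3 // k ≠ j}) → Fin (msgCount n (R k.1 ⟨j, k.2.symm⟩))

/-- The components of `m` that are intended for user `j`. -/
def wanted {R : RateTuple} {n : ℕ} (m : Messages R n) (j : Fin 3) : Wanted R n j :=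
  fun k => m k.1 ⟨j, k.2.symm⟩

/-- The sample space: the six messages, the noise at the relay, the noises at the users. -/
abbrev Outcome (R : RateTuple) (n : ℕ) : Type :=
  Messages R n × (Fin n → ℝ) × (Fin 3 → Fin n → ℝ)

/-- The law of the messages and noises: the messages are uniform (so the six of them are mutually
independent), all noise samples are standard Gaussian, and everything is independent. -/
def law (R : RateTuple) (n : ℕ) : Measure (Outcome R n) :=
  (uniformOn (Set.univ : Set (Messages R n))).prod
    ((Measure.pi fun _ : Fin n => gaussianReal 0 1).prod
      (Measure.pi fun _ : Fin 3 => Measure.pi fun _ : Fin n => gaussianReal 0 1))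

/-- The encoders and decoders of a code of rate `R` and length `n` with restricted encoding: the
codeword of user `j` depends on the two messages of user `j` only. The relay's `i`-th symbol is a
function of the symbols it received strictly before time `i`. -/
structure Code (R : RateTuple) (n : ℕ) where
  /-- the encoder of user `j` -/
  enc : (j : Fin 3) → Own R n j → Fin n → ℝ
  /-- the relay's encoder at time `i` -/
  relay : (i : Fin n) → (Fin i → ℝ) → ℝ
  /-- the decoder of user `j`, applied to its received sequence and its own messages -/
  dec : (j : Fin 3) → (Fin n → ℝ) → Own R n j → Wanted R n j
  measurable_relay : ∀ i, Measurable (relay i)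
  measurable_dec : ∀ j m, Measurable fun y => dec j y m

namespace Code

variable {R : RateTuple} {n : ℕ} (c : Code R n) (h : Fin 3 → ℝ)

/-- The symbol sent by user `j` at time `i`. -/
def userSignal (j : Fin 3) (i : Fin n) (ω : Outcome R n) : ℝ := c.enc j (ω.1 j) i

/-- The symbol received by the relay at time `i`. -/
def relayReceived (i : Fin n) (ω : Outcome R n) : ℝ :=
  ∑ j, h j * c.userSignal j i ω + ω.2.1 i

/-- The symbol sent by the relay at time `i`. -/
def relaySignal (i : Fin n) (ω : Outcome R n) : ℝ :=
  c.relay i fun t => c.relayReceived h (Fin.castLE i.isLt.le t) ω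

/-- The symbol received by user `j` at time `i`. -/
def userReceived (j : Fin 3) (i : Fin n) (ω : Outcome R n) : ℝ :=
  h j * c.relaySignal h i ω + ω.2.2 j i

/-- The event that some user decodes its two messages wrongly. -/
def errorEvent : Set (Outcome R n) :=
  {ω | ∃ j, c.dec j (fun i => c.userReceived h j i ω) (ω.1 j) ≠ wanted ω.1 j}

/-- The average error probability. -/
def errorProb : ℝ := (law R n).real (c.errorEvent h)

end Code

/-- The average power constraint `(1/n) ∑ᵢ E[Xᵢ²] ≤ P` (all second moments being finite). -/
def PowerConstraint {R : RateTuple} {n : ℕ} (P : ℝ) (X : Fin n → Outcome R n → ℝ) : Prop :=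
  (∀ i, Integrable (fun ω => X i ω ^ 2) (law R n)) ∧
    1 / (n : ℝ) * ∑ i, ∫ ω, X i ω ^ 2 ∂(law R n) ≤ P

/-- The users and the relay obey the power constraint `P`. -/
def Code.IsAdmissible {R : RateTuple} {n : ℕ} (c : Code R n) (h : Fin 3 → ℝ) (P : ℝ) : Prop :=
  (∀ j, PowerConstraint P (c.userSignal j)) ∧ PowerConstraint P (c.relaySignal h)

/-- The capacity region of the restricted Y-channel with gains `h` and power `P`: the set of
achievable rate tuples. -/
def capacityRegion (h : Fin 3 → ℝ) (P : ℝ) : Set RateTuple :=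
  {R | (∀ j k, 0 ≤ R j k) ∧ ∃ c : (n : ℕ) → Code R n,
    (∀ n, (c n).IsAdmissible h P) ∧ Tendsto (fun n => (c n).errorProb h) atTop (𝓝 0)}

/-- The sum-capacity of the restricted Y-channel, as a supremum in the extended reals. -/
def sumCapacity (h : Fin 3 → ℝ) (P : ℝ) : EReal :=
  ⨆ R ∈ capacityRegion h P, (sumRate R : EReal)

/-- `C(x) = (1/2) log₂ (1 + x)`. -/
def gaussCap (x : ℝ) : ℝ := 1 / 2 * Real.logb 2 (1 + x)

end

end YChannel

section GaussianTools

open scoped ENNReal NNReal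

namespace MeasureTheory

variable {ι : Type*} [Fintype ι] {E : ι → Type*} [∀ i, MeasurableSpace (E i)]

theorem lintegral_pi_prod (μ : ∀ i, Measure (E i)) [∀ i, IsProbabilityMeasure (μ i)]
    {f : ∀ i, E i → ℝ≥0∞} (hf : ∀ i, Measurable (f i)) :
    ∫⁻ x, ∏ i, f i (x i) ∂Measure.pi μ = ∏ i, ∫⁻ x, f i x ∂μ i := by
  have hind : iIndepFun (fun i (x : ∀ i, E i) => f i (x i)) (Measure.pi μ) :=
    iIndepFun_pi (fun i => (hf i).aemeasurable)
  have := lintegral_prod_eq_prod_lintegral_of_indepFun Finset.univ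
    (fun i (x : ∀ i, E i) => f i (x i)) hind (fun i => (hf i).comp (measurable_pi_apply i))
  rw [this]
  exact Finset.prod_congr rfl fun i _ =>
    (measurePreserving_eval μ i).lintegral_comp (hf i)

theorem pi_withDensity_prod (μ ν : ∀ i, Measure (E i)) [∀ i, IsProbabilityMeasure (μ i)]
    [∀ i, IsProbabilityMeasure (ν i)] {f : ∀ i, E i → ℝ≥0∞} (hf : ∀ i, Measurable (f i))
    (h : ∀ i, (μ i).withDensity (f i) = ν i) :
    (Measure.pi μ).withDensity (fun x => ∏ i, f i (x i)) = Measure.pi ν := by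
  refine (Measure.pi_eq fun t ht => ?_).symm
  rw [withDensity_apply _ (MeasurableSet.univ_pi ht), ← lintegral_indicator (MeasurableSet.univ_pi ht)]
  have key : ∀ x : ∀ i, E i, (Set.univ.pi t).indicator (fun x => ∏ i, f i (x i)) x
      = ∏ i, (t i).indicator (f i) (x i) := by
    intro x
    by_cases hx : ∀ i, x i ∈ t i
    · rw [Set.indicator_of_mem (by simpa using hx)]
      exact Finset.prod_congr rfl fun i _ => (Set.indicator_of_mem (hx i) _).symm
    · rw [Set.indicator_of_notMem (by simpa using hx)]
      push Not at hx
      obtain ⟨i, hi⟩ := hx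
      exact (Finset.prod_eq_zero (Finset.mem_univ i) (Set.indicator_of_notMem hi _)).symm
  simp_rw [key]
  rw [lintegral_pi_prod μ fun i => (hf i).indicator (ht i)]
  refine Finset.prod_congr rfl fun i _ => ?_
  rw [lintegral_indicator (ht i), ← withDensity_apply _ (ht i), h i]

end MeasureTheory

namespace ProbabilityTheory

theorem gaussianReal_withDensity_exp (x : ℝ) :
    (gaussianReal 0 1).withDensity (fun z => ENNReal.ofReal (Real.exp (-(x * z + x ^ 2 / 2))))
      = gaussianReal (-x) 1 := by
  rw [gaussianReal_of_var_ne_zero _ one_ne_zero, gaussianReal_of_var_ne_zero _ one_ne_zero,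
    ← withDensity_mul _ (measurable_gaussianPDF 0 1) (by fun_prop)]
  congr 1
  ext z
  simp only [Pi.mul_apply, gaussianPDF_def]
  rw [← ENNReal.ofReal_mul (gaussianPDFReal_nonneg _ _ _)]
  congr 1
  simp only [gaussianPDFReal_def]
  rw [mul_assoc, ← Real.exp_add]
  congr 2
  simp only [NNReal.coe_one]
  ring

theorem lintegral_exp_quadratic_gaussianReal {s : ℝ} (hs : 0 ≤ s) (P : ℝ≥0) (w : ℝ) :
    ∫⁻ x, ENNReal.ofReal (Real.exp (x * w - s * x ^ 2 / 2)) ∂gaussianReal 0 P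
      = ENNReal.ofReal (Real.exp (-(1 / 2 * Real.log (1 + s * P))
          + P * w ^ 2 / (2 * (1 + s * P)))) := by
  rcases eq_or_ne P 0 with rfl | hP
  · simp
  have hP0 : (0 : ℝ) < P := by positivity
  have h1 : 0 < 1 + s * (P : ℝ) := by positivity
  set v : ℝ≥0 := ⟨P / (1 + s * P), by positivity⟩
  have hvc : (v : ℝ) = P / (1 + s * P) := rfl
  have hv0 : v ≠ 0 := by
    have : (0 : ℝ) < v := by rw [hvc]; positivity
    exact_mod_cast this.ne'
  rw [gaussianReal_of_var_ne_zero _ hP,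
    lintegral_withDensity_eq_lintegral_mul _ (measurable_gaussianPDF 0 P) (by fun_prop)]
  have key : ∀ x, (gaussianPDF 0 P * fun x => ENNReal.ofReal (Real.exp (x * w - s * x ^ 2 / 2))) x
      = ENNReal.ofReal (Real.exp (-(1 / 2 * Real.log (1 + s * P))
          + P * w ^ 2 / (2 * (1 + s * P)))) * gaussianPDF (w * v) v x := by
    intro x
    simp only [Pi.mul_apply, gaussianPDF_def]
    rw [← ENNReal.ofReal_mul (gaussianPDFReal_nonneg _ _ _), ← ENNReal.ofReal_mul (by positivity)]
    congr 1
    simp only [gaussianPDFReal_def]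
    have e1 : Real.exp (-(1 / 2 * Real.log (1 + s * P))) = (√(1 + s * P))⁻¹ := by
      rw [Real.exp_neg, Real.sqrt_eq_rpow, Real.rpow_def_of_pos h1, mul_comm]
    have e2 : √(2 * Real.pi * v) = √(2 * Real.pi * P) * (√(1 + s * P))⁻¹ := by
      rw [hvc, ← mul_div_assoc, Real.sqrt_div (by positivity), div_eq_mul_inv]
    rw [Real.exp_add, e1, e2, mul_inv, inv_inv, mul_assoc, ← Real.exp_add]
    have : √(1 + s * (P : ℝ)) ≠ 0 := (Real.sqrt_pos.2 h1).ne'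
    have e3 : ∀ a b c d : ℝ, a ≠ 0 → a⁻¹ * b * (c * a * d) = c * (b * d) := by
      intro a b c d ha; field_simp
    rw [e3 _ _ _ _ this, ← Real.exp_add]
    congr 2
    rw [hvc]
    field_simp
    ring
  simp_rw [key]
  rw [lintegral_const_mul _ (measurable_gaussianPDF _ _), lintegral_gaussianPDF_eq_one _ hv0, mul_one]

end ProbabilityTheory

end GaussianTools

section GaussianConverse

open scoped ENNReal NNReal

/-- A Gaussian observation space: a vector `x` acts on the noise space `Z` by translations
`shift x`, the translated noise is absolutely continuous with the Cameron–Martin density driven by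
the statistic `stat`, and each coordinate of `stat` is centred with variance `s`. -/
structure GaussianShift (n : ℕ) (s : ℝ) {Z : Type*} [MeasurableSpace Z] (γ : Measure Z) where
  /-- the observation when `x` is sent and the noise is `z` -/
  shift : (Fin n → ℝ) → Z → Z
  /-- the sufficient statistic -/
  stat : Z → Fin n → ℝ
  measurable_shift : Measurable fun p : (Fin n → ℝ) × Z => shift p.1 p.2
  measurable_stat : Measurable stat
  stat_shift : ∀ x z i, stat (shift x z) i = stat z i + s * x i
  lintegral_shift : ∀ (x : Fin n → ℝ) (F : Z → ℝ≥0∞), Measurable F →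
    ∫⁻ z, F (shift x z) * ENNReal.ofReal (Real.exp (-∑ i, (x i * stat z i + s * x i ^ 2 / 2))) ∂γ
      = ∫⁻ z, F z ∂γ
  memLp_stat : ∀ i, MemLp (fun z => stat z i) 2 γ
  integral_stat : ∀ i, ∫ z, stat z i ∂γ = 0
  integral_stat_sq : ∀ i, ∫ z, stat z i ^ 2 ∂γ = s

namespace GaussianShift

variable {n : ℕ} {s : ℝ} {Z : Type*} [MeasurableSpace Z] {γ : Measure Z}

theorem measurable_stat_apply (G : GaussianShift n s γ) (i : Fin n) :
    Measurable fun z => G.stat z i :=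
  (measurable_pi_apply i).comp G.measurable_stat

/-- The logarithm of the density, with respect to the noise, of the output law under Gaussian
inputs of variance `P`. -/
noncomputable def logOutputDensity (G : GaussianShift n s γ) (P : ℝ≥0) (z : Z) : ℝ :=
  ∑ i, (-(1 / 2 * Real.log (1 + s * P)) + P * G.stat z i ^ 2 / (2 * (1 + s * P)))

theorem measurable_logOutputDensity (G : GaussianShift n s γ) (P : ℝ≥0) :
    Measurable (G.logOutputDensity P) := by
  have := G.measurable_stat_apply
  unfold logOutputDensity
  fun_prop

theorem lintegral_exp_logOutputDensity [IsProbabilityMeasure γ] (G : GaussianShift n s γ)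
    (hs : 0 ≤ s) (P : ℝ≥0) :
    ∫⁻ z, ENNReal.ofReal (Real.exp (G.logOutputDensity P z)) ∂γ = 1 := by
  have hstat := G.measurable_stat_apply
  have mix : ∀ z, ENNReal.ofReal (Real.exp (G.logOutputDensity P z))
      = ∫⁻ x, ENNReal.ofReal (Real.exp (∑ i, (x i * G.stat z i - s * x i ^ 2 / 2)))
        ∂Measure.pi (fun _ : Fin n => gaussianReal 0 P) := by
    intro z
    rw [logOutputDensity, Real.exp_sum, ENNReal.ofReal_prod_of_nonneg fun i _ => (Real.exp_pos _).le]
    simp_rw [← lintegral_exp_quadratic_gaussianReal hs P, Real.exp_sum]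
    rw [← lintegral_pi_prod (fun _ : Fin n => gaussianReal 0 P)
      (f := fun i t => ENNReal.ofReal (Real.exp (t * G.stat z i - s * t ^ 2 / 2)))
      (fun i => by fun_prop)]
    exact lintegral_congr fun x =>
      (ENNReal.ofReal_prod_of_nonneg fun i _ => (Real.exp_pos _).le).symm
  simp_rw [mix]
  rw [lintegral_lintegral_swap]
  · have one : ∀ x : Fin n → ℝ,
        ∫⁻ z, ENNReal.ofReal (Real.exp (∑ i, (x i * G.stat z i - s * x i ^ 2 / 2))) ∂γ = 1 := by
      intro x
      rw [← G.lintegral_shift x _ (by fun_prop)]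
      have : ∀ z, ENNReal.ofReal
            (Real.exp (∑ i, (x i * G.stat (G.shift x z) i - s * x i ^ 2 / 2)))
          * ENNReal.ofReal (Real.exp (-∑ i, (x i * G.stat z i + s * x i ^ 2 / 2))) = 1 := by
        intro z
        rw [← ENNReal.ofReal_mul (Real.exp_pos _).le, ← Real.exp_add, ← sub_eq_add_neg,
          ← Finset.sum_sub_distrib, Finset.sum_eq_zero, Real.exp_zero, ENNReal.ofReal_one]
        intro i _
        rw [G.stat_shift]
        ring
      simp_rw [this]
      simp
    simp_rw [one]
    simp
  · have h1 : ∀ i, Measurable fun p : Z × (Fin n → ℝ) => G.stat p.1 i :=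
      fun i => (hstat i).comp measurable_fst
    have : Measurable (Function.uncurry fun (z : Z) (x : Fin n → ℝ) =>
        ENNReal.ofReal (Real.exp (∑ i, (x i * G.stat z i - s * x i ^ 2 / 2)))) := by
      unfold Function.uncurry
      fun_prop
    exact this.aemeasurable

variable {S : Type*} [MeasurableSpace S] {μ : Measure S}

/-- The information density of an input `X` against the Gaussian output law. -/
noncomputable def infoDensity (G : GaussianShift n s γ) (P : ℝ≥0) (X : S → Fin n → ℝ)
    (p : S × Z) : ℝ :=
  ∑ i, (X p.1 i * G.stat p.2 i + s * X p.1 i ^ 2 / 2)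
    - G.logOutputDensity P (G.shift (X p.1) p.2)

omit [MeasurableSpace S] in
theorem infoDensity_eq (G : GaussianShift n s γ) (hs : 0 ≤ s) (P : ℝ≥0) (X : S → Fin n → ℝ)
    (p : S × Z) :
    G.infoDensity P X p = ∑ i, (1 / (1 + s * P) * (X p.1 i * G.stat p.2 i)
      + s / (2 * (1 + s * P)) * (X p.1 i ^ 2)
      - P / (2 * (1 + s * P)) * (G.stat p.2 i ^ 2) + 1 / 2 * Real.log (1 + s * P)) := by
  have h1 : 0 < 1 + s * (P : ℝ) := by positivity
  rw [infoDensity, logOutputDensity, ← Finset.sum_sub_distrib]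
  refine Finset.sum_congr rfl fun i _ => ?_
  rw [G.stat_shift]
  field_simp
  ring

section moments

variable [IsProbabilityMeasure μ] [IsProbabilityMeasure γ] (G : GaussianShift n s γ) (hs : 0 ≤ s)
  (P : ℝ≥0) {X : S → Fin n → ℝ} (hX : Measurable X)
  (hXint : ∀ i, Integrable (fun a => X a i ^ 2) μ)

include hX hXint in
theorem integrable_input_mul_stat (i : Fin n) :
    Integrable (fun p : S × Z => X p.1 i * G.stat p.2 i) (μ.prod γ) := by
  have hXi : MemLp (fun a => X a i) 2 μ :=
    (memLp_two_iff_integrable_sq ((measurable_pi_apply i).comp hX).aestronglyMeasurable).2 (hXint i)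
  exact (hXi.integrable one_le_two).mul_prod ((G.memLp_stat i).integrable one_le_two)

include hs hX hXint in
theorem integrable_infoDensity : Integrable (G.infoDensity P X) (μ.prod γ) := by
  have : G.infoDensity P X = fun p => _ := funext (G.infoDensity_eq hs P X)
  rw [this]
  refine integrable_finsetSum _ fun i _ => ?_
  exact ((((G.integrable_input_mul_stat hX hXint i).const_mul _).add
    (((hXint i).comp_fst γ).const_mul _)).sub
    (((G.memLp_stat i).integrable_sq.comp_snd μ).const_mul _)).add (integrable_const _)

include hs hX hXint in
theorem integral_infoDensity : ∫ p, G.infoDensity P X p ∂(μ.prod γ)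
    = n * (1 / 2 * Real.log (1 + s * P))
      + s / (2 * (1 + s * P)) * (∑ i, ∫ a, X a i ^ 2 ∂μ - n * P) := by
  simp_rw [G.infoDensity_eq hs P X]
  have i1 := fun i => (G.integrable_input_mul_stat hX hXint i).const_mul (1 / (1 + s * (P : ℝ)))
  have i2 := fun i => ((hXint i).comp_fst γ).const_mul (s / (2 * (1 + s * (P : ℝ))))
  have i3 := fun i => ((G.memLp_stat i).integrable_sq.comp_snd μ).const_mul
    ((P : ℝ) / (2 * (1 + s * (P : ℝ))))
  have i12 : ∀ i, Integrable (fun p : S × Z => 1 / (1 + s * P) * (X p.1 i * G.stat p.2 i)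
      + s / (2 * (1 + s * P)) * (X p.1 i ^ 2)) (μ.prod γ) := fun i => (i1 i).add (i2 i)
  have i123 : ∀ i, Integrable (fun p : S × Z => 1 / (1 + s * P) * (X p.1 i * G.stat p.2 i)
      + s / (2 * (1 + s * P)) * (X p.1 i ^ 2)
      - P / (2 * (1 + s * P)) * (G.stat p.2 i ^ 2)) (μ.prod γ) := fun i => (i12 i).sub (i3 i)
  rw [integral_finsetSum]
  · have term : ∀ i, ∫ p : S × Z, (1 / (1 + s * P) * (X p.1 i * G.stat p.2 i)
        + s / (2 * (1 + s * P)) * (X p.1 i ^ 2)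
        - P / (2 * (1 + s * P)) * (G.stat p.2 i ^ 2) + 1 / 2 * Real.log (1 + s * P)) ∂(μ.prod γ)
        = s / (2 * (1 + s * P)) * ∫ a, X a i ^ 2 ∂μ - P / (2 * (1 + s * P)) * s
          + 1 / 2 * Real.log (1 + s * P) := by
      intro i
      rw [integral_add (i123 i) (integrable_const _),
        integral_sub (i12 i) (i3 i), integral_add (i1 i) (i2 i)]
      simp only [integral_const_mul]
      rw [integral_prod_mul (fun a => X a i) (fun z => G.stat z i), G.integral_stat,
        integral_fun_fst (fun a => X a i ^ 2), integral_fun_snd (fun z => G.stat z i ^ 2),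
        G.integral_stat_sq]
      simp
    simp_rw [term]
    rw [Finset.sum_add_distrib, Finset.sum_sub_distrib, ← Finset.mul_sum]
    simp only [Finset.sum_const, Finset.card_univ, Fintype.card_fin, nsmul_eq_mul]
    ring
  · exact fun i _ => (i123 i).add (integrable_const _)

end moments

theorem lintegral_exp_sub_infoDensity_le [IsProbabilityMeasure μ] [IsProbabilityMeasure γ]
    (G : GaussianShift n s γ) (hs : 0 ≤ s) (P : ℝ≥0) {X : S → Fin n → ℝ} (hX : Measurable X)
    {D : Set (S × Z)} (hD : MeasurableSet D) {K : ℝ} (hK : 1 ≤ K)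
    (hslice : ∀ y, μ {a | (a, y) ∈ D} ≤ ENNReal.ofReal (1 / K)) :
    ∫⁻ p, ENNReal.ofReal (Real.exp
      ({p : S × Z | (p.1, G.shift (X p.1) p.2) ∈ D}.indicator (fun _ => Real.log K) p
        - G.infoDensity P X p)) ∂(μ.prod γ) ≤ 2 := by
  have hshift : Measurable fun p : S × Z => G.shift (X p.1) p.2 :=
    G.measurable_shift.comp ((hX.comp measurable_fst).prodMk measurable_snd)
  set q : Z → ℝ≥0∞ := fun y => ENNReal.ofReal (Real.exp (G.logOutputDensity P y))
  have hqm : Measurable q := by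
    have := G.measurable_logOutputDensity P
    fun_prop
  set F : S × Z → ℝ≥0∞ := fun p => (1 + D.indicator (fun _ => ENNReal.ofReal K) p) * q p.2 with hF
  have hFm : Measurable F :=
    (measurable_const.add (measurable_const.indicator hD)).mul (hqm.comp measurable_snd)
  have hstat : ∀ i, Measurable fun p : S × Z => G.stat p.2 i :=
    fun i => (G.measurable_stat_apply i).comp measurable_snd
  have hXm : ∀ i, Measurable fun p : S × Z => X p.1 i :=
    fun i => (measurable_pi_apply i).comp (hX.comp measurable_fst)
  calc _ ≤ ∫⁻ p : S × Z, F (p.1, G.shift (X p.1) p.2) * ENNReal.ofReal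
        (Real.exp (-∑ i, (X p.1 i * G.stat p.2 i + s * X p.1 i ^ 2 / 2))) ∂(μ.prod γ) := by
        refine lintegral_mono fun p => ?_
        have e : ∀ t, Real.exp (t - G.infoDensity P X p)
            = Real.exp t * Real.exp (G.logOutputDensity P (G.shift (X p.1) p.2))
              * Real.exp (-∑ i, (X p.1 i * G.stat p.2 i + s * X p.1 i ^ 2 / 2)) := by
          intro t
          rw [← Real.exp_add, ← Real.exp_add, infoDensity]
          congr 1
          ring
        rw [e, ENNReal.ofReal_mul (by positivity), ENNReal.ofReal_mul (by positivity)]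
        gcongr
        simp only [hF]
        gcongr
        by_cases hp : (p.1, G.shift (X p.1) p.2) ∈ D
        · rw [Set.indicator_of_mem (by exact hp), Set.indicator_of_mem hp,
            Real.exp_log (by linarith)]
          exact le_add_self
        · rw [Set.indicator_of_notMem (by exact hp), Set.indicator_of_notMem hp]
          simp
    _ = ∫⁻ a, ∫⁻ z, F (a, z) ∂γ ∂μ := by
        rw [lintegral_prod]
        · exact lintegral_congr fun a =>
            G.lintegral_shift (X a) (fun z => F (a, z)) (hFm.comp measurable_prodMk_left)
        · refine Measurable.aemeasurable (Measurable.mul ?_ (by fun_prop))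
          exact hFm.comp (measurable_fst.prodMk hshift)
    _ = ∫⁻ z, ∫⁻ a, F (a, z) ∂μ ∂γ := lintegral_lintegral_swap hFm.aemeasurable
    _ ≤ ∫⁻ z, 2 * q z ∂γ := by
        refine lintegral_mono fun z => ?_
        simp only [hF]
        have hDz : MeasurableSet {a | (a, z) ∈ D} := measurable_prodMk_right hD
        have hi : ∀ a, D.indicator (fun _ => ENNReal.ofReal K) (a, z)
            = {a | (a, z) ∈ D}.indicator (fun _ => ENNReal.ofReal K) a := fun a => rfl
        simp_rw [hi]
        have hm : Measurable fun a =>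
            1 + {a | (a, z) ∈ D}.indicator (fun _ => ENNReal.ofReal K) a :=
          (measurable_const.indicator hDz).const_add 1
        rw [lintegral_mul_const _ hm, lintegral_add_left measurable_const, lintegral_indicator_const hDz]
        gcongr
        rw [lintegral_const, measure_univ, one_mul, ← one_add_one_eq_two]
        gcongr
        calc _ ≤ ENNReal.ofReal K * ENNReal.ofReal (1 / K) := by gcongr; exact hslice z
          _ = 1 := by
            rw [← ENNReal.ofReal_mul (by linarith), mul_one_div_cancel (by linarith),
              ENNReal.ofReal_one]
    _ = 2 := by
        rw [lintegral_const_mul _ hqm, G.lintegral_exp_logOutputDensity hs, mul_one]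

/-- Converse for a Gaussian channel with an average power constraint: a list decoding set `D` with
slices of probability at most `1 / K` is hit with probability at most about
`n log (1 + s P) / (2 log K)`. -/
theorem measureReal_mul_log_le [IsProbabilityMeasure μ] [IsProbabilityMeasure γ]
    (G : GaussianShift n s γ) (hs : 0 ≤ s) (P : ℝ≥0) {X : S → Fin n → ℝ} (hX : Measurable X)
    (hXint : ∀ i, Integrable (fun a => X a i ^ 2) μ) (hXP : ∑ i, ∫ a, X a i ^ 2 ∂μ ≤ n * P)
    {D : Set (S × Z)} (hD : MeasurableSet D) {K : ℝ} (hK : 1 ≤ K)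
    (hslice : ∀ y, μ {a | (a, y) ∈ D} ≤ ENNReal.ofReal (1 / K)) :
    (μ.prod γ).real {p | (p.1, G.shift (X p.1) p.2) ∈ D} * Real.log K
      ≤ n * (1 / 2 * Real.log (1 + s * P)) + Real.log 2 := by
  have hshift : Measurable fun p : S × Z => G.shift (X p.1) p.2 :=
    G.measurable_shift.comp ((hX.comp measurable_fst).prodMk measurable_snd)
  set A : Set (S × Z) := {p | (p.1, G.shift (X p.1) p.2) ∈ D}
  have hAm : MeasurableSet A := (measurable_fst.prodMk hshift) hD
  set f : S × Z → ℝ := A.indicator fun _ => Real.log K with hf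
  have hfi : Integrable f (μ.prod γ) := (integrable_const _).indicator hAm
  have hLi := G.integrable_infoDensity hs P hX hXint
  have hle := G.lintegral_exp_sub_infoDensity_le hs P hX hD hK hslice
  have hm : AEStronglyMeasurable (fun p => Real.exp (f p - G.infoDensity P X p)) (μ.prod γ) :=
    Real.continuous_exp.comp_aestronglyMeasurable (hfi.sub hLi).aestronglyMeasurable
  have hei : Integrable (fun p => Real.exp (f p - G.infoDensity P X p)) (μ.prod γ) := by
    refine ⟨hm, ?_⟩
    rw [hasFiniteIntegral_iff_ofReal (Eventually.of_forall fun _ => (Real.exp_pos _).le)]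
    exact hle.trans_lt (by simp)
  have hint : ∫ p, Real.exp (f p - G.infoDensity P X p) ∂(μ.prod γ) ≤ 2 := by
    rw [integral_eq_lintegral_of_nonneg_ae (Eventually.of_forall fun _ => (Real.exp_pos _).le) hm]
    exact ENNReal.toReal_le_of_le_ofReal (by norm_num) (by simpa using hle)
  have hpt : ∀ p, f p - G.infoDensity P X p
      ≤ Real.exp (f p - G.infoDensity P X p) / 2 + (Real.log 2 - 1) := by
    intro p
    have := Real.add_one_le_exp (f p - G.infoDensity P X p - Real.log 2)
    rw [Real.exp_sub _ (Real.log 2), Real.exp_log two_pos] at this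
    linarith
  have hmono := integral_mono (hfi.sub hLi) ((hei.div_const 2).add (integrable_const _)) hpt
  simp only [Pi.add_apply, Pi.sub_apply] at hmono
  rw [integral_sub hfi hLi, integral_add (hei.div_const 2) (integrable_const _), integral_div,
    G.integral_infoDensity hs P hX hXint, hf, integral_indicator_const _ hAm] at hmono
  simp only [integral_const, probReal_univ, smul_eq_mul, one_mul] at hmono
  have h1 : 0 ≤ s / (2 * (1 + s * (P : ℝ))) := by positivity
  have h2 := mul_nonpos_of_nonneg_of_nonpos h1 (sub_nonpos.2 hXP)
  linarith

end GaussianShift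

end GaussianConverse

section GaussianShiftInstances

open scoped ENNReal NNReal

/-- The law of independent standard Gaussian samples indexed by `ι`. -/
noncomputable abbrev stdGaussianPi (ι : Type*) [Fintype ι] : Measure (ι → ℝ) :=
  Measure.pi fun _ : ι => gaussianReal 0 1

section

variable {ι : Type*} [Fintype ι]

theorem stdGaussianPi_withDensity (x : ι → ℝ) :
    (stdGaussianPi ι).withDensity
        (fun z => ENNReal.ofReal (Real.exp (-∑ i, (x i * z i + x i ^ 2 / 2))))
      = Measure.pi fun i => gaussianReal (-x i) 1 := by
  rw [← pi_withDensity_prod (fun _ : ι => gaussianReal 0 1) (fun i => gaussianReal (-x i) 1)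
    (f := fun i z => ENNReal.ofReal (Real.exp (-(x i * z + x i ^ 2 / 2))))
    (fun i => by fun_prop) (fun i => gaussianReal_withDensity_exp (x i))]
  congr 1
  ext z
  rw [← Finset.sum_neg_distrib, Real.exp_sum,
    ENNReal.ofReal_prod_of_nonneg fun i _ => (Real.exp_pos _).le]

theorem pi_gaussianReal_neg_map_add (x : ι → ℝ) :
    (Measure.pi fun i => gaussianReal (-x i) 1).map (fun z => z + x) = stdGaussianPi ι := by
  have := Measure.pi_map_pi (μ := fun i => gaussianReal (-x i) 1) (f := fun i z => z + x i)
    (fun i => by fun_prop)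
  simp_rw [gaussianReal_map_add_const, neg_add_cancel] at this
  exact this

theorem memLp_eval_stdGaussianPi (i : ι) : MemLp (fun z => z i) 2 (stdGaussianPi ι) :=
  (memLp_id_gaussianReal (μ := 0) (v := 1) 2).comp_measurePreserving
    (measurePreserving_eval (fun _ : ι => gaussianReal 0 1) i)

theorem integral_eval_stdGaussianPi (i : ι) : ∫ z, z i ∂stdGaussianPi ι = 0 := by
  rw [integral_comp_eval (μ := fun _ : ι => gaussianReal 0 1) (f := fun t : ℝ => t)
    (by fun_prop)]
  simp

theorem variance_eval_stdGaussianPi (i : ι) : Var[fun z => z i; stdGaussianPi ι] = 1 := by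
  have h := measurePreserving_eval (fun _ : ι => gaussianReal 0 1) i
  have hid : Var[id; gaussianReal 0 1] = 1 := by simp
  rw [← h.map_eq, variance_map measurable_id.aemeasurable h.measurable.aemeasurable] at hid
  exact hid

theorem integral_eval_sq_stdGaussianPi (i : ι) : ∫ z, z i ^ 2 ∂stdGaussianPi ι = 1 := by
  rw [← variance_eval_stdGaussianPi i, variance_of_integral_eq_zero (measurable_pi_apply i).aemeasurable
    (integral_eval_stdGaussianPi i)]

end

variable {n : ℕ} {J : Type*} [Fintype J]

theorem lintegral_shift_of_map {Z : Type*} [MeasurableSpace Z] {γ γ' : Measure Z} {T : Z → Z}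
    (hT : Measurable T) {d : Z → ℝ≥0∞} (hd : Measurable d) (h : γ.withDensity d = γ')
    (hmap : γ'.map T = γ) {F : Z → ℝ≥0∞} (hF : Measurable F) :
    ∫⁻ z, F (T z) * d z ∂γ = ∫⁻ z, F z ∂γ := by
  conv_rhs => rw [← hmap, lintegral_map hF hT, ← h,
    lintegral_withDensity_eq_lintegral_mul _ hd (g := fun z => F (T z)) (hF.comp hT)]
  simp only [Pi.mul_apply, mul_comm]

/-- The additive Gaussian noise channel with one output. -/
noncomputable def GaussianShift.single (n : ℕ) : GaussianShift n 1 (stdGaussianPi (Fin n)) where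
  shift x z := z + x
  stat z := z
  measurable_shift := by fun_prop
  measurable_stat := measurable_id
  stat_shift x z i := by simp
  lintegral_shift x F hF := by
    simp only [one_mul]
    exact lintegral_shift_of_map (T := fun z => z + x) (by fun_prop) (by fun_prop)
      (stdGaussianPi_withDensity x) (pi_gaussianReal_neg_map_add x) hF
  memLp_stat := memLp_eval_stdGaussianPi
  integral_stat := integral_eval_stdGaussianPi
  integral_stat_sq := integral_eval_sq_stdGaussianPi

theorem memLp_eval_eval (j : J) (i : Fin n) :
    MemLp (fun z : J → Fin n → ℝ => z j i) 2 (Measure.pi fun _ : J => stdGaussianPi (Fin n)) :=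
  (memLp_eval_stdGaussianPi i).comp_measurePreserving
    (measurePreserving_eval (fun _ : J => stdGaussianPi (Fin n)) j)

theorem integral_sum_mul_eval (a : J → ℝ) (i : Fin n) :
    ∫ z, ∑ j, a j * z j i ∂(Measure.pi fun _ : J => stdGaussianPi (Fin n)) = 0 := by
  rw [integral_finsetSum _ fun j _ => ((memLp_eval_eval j i).integrable one_le_two).const_mul _]
  refine Finset.sum_eq_zero fun j _ => ?_
  rw [integral_const_mul, integral_comp_eval (μ := fun _ : J => stdGaussianPi (Fin n))
    (f := fun t : Fin n → ℝ => t i) (measurable_pi_apply i).aestronglyMeasurable, integral_eval_stdGaussianPi, mul_zero]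

theorem integral_sum_mul_eval_sq (a : J → ℝ) (i : Fin n) :
    ∫ z, (∑ j, a j * z j i) ^ 2 ∂(Measure.pi fun _ : J => stdGaussianPi (Fin n))
      = ∑ j, a j ^ 2 := by
  rw [← variance_of_integral_eq_zero
    (by fun_prop : Measurable fun z : J → Fin n → ℝ => ∑ j, a j * z j i).aemeasurable
    (integral_sum_mul_eval a i)]
  have := variance_sum_pi (μ := fun _ : J => stdGaussianPi (Fin n))
    (X := fun j t => a j * t i) fun j => (memLp_eval_stdGaussianPi i).const_mul (a j)
  have e : (∑ j, fun z : J → Fin n → ℝ => a j * z j i) = fun z => ∑ j, a j * z j i := by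
    ext z; simp
  rw [← e, this]
  refine Finset.sum_congr rfl fun j _ => ?_
  rw [variance_const_mul, variance_eval_stdGaussianPi, mul_one]

/-- The additive Gaussian noise channel with several outputs, of gains `a`. -/
noncomputable def GaussianShift.multi (n : ℕ) (a : J → ℝ) :
    GaussianShift n (∑ j, a j ^ 2) (Measure.pi fun _ : J => stdGaussianPi (Fin n)) where
  shift x z := fun j => z j + a j • x
  stat z i := ∑ j, a j * z j i
  measurable_shift := by fun_prop
  measurable_stat := by fun_prop
  stat_shift x z i := by
    simp only [Pi.add_apply, Pi.smul_apply, smul_eq_mul, mul_add, Finset.sum_add_distrib,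
      Finset.sum_mul]
    congr 1
    exact Finset.sum_congr rfl fun j _ => by ring
  lintegral_shift x F hF := by
    refine lintegral_shift_of_map (T := fun z j => z j + a j • x)
      (γ' := Measure.pi fun j => Measure.pi fun i => gaussianReal (-(a j • x) i) 1)
      (by fun_prop) (by fun_prop) ?_ ?_ hF
    · rw [← pi_withDensity_prod (fun _ : J => stdGaussianPi (Fin n)) _
        (f := fun j z => ENNReal.ofReal
          (Real.exp (-∑ i, ((a j • x) i * z i + (a j • x) i ^ 2 / 2))))
        (fun j => by fun_prop) (fun j => stdGaussianPi_withDensity (a j • x))]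
      congr 1
      ext z
      rw [← ENNReal.ofReal_prod_of_nonneg fun i _ => (Real.exp_pos _).le, ← Real.exp_sum,
        Finset.sum_neg_distrib, Finset.sum_comm]
      congr 3
      refine Finset.sum_congr rfl fun i _ => ?_
      simp only [Pi.smul_apply, smul_eq_mul, Finset.sum_add_distrib, Finset.mul_sum,
        Finset.sum_mul, Finset.sum_div]
      congr 1 <;> exact Finset.sum_congr rfl fun j _ => by ring
    · have := Measure.pi_map_pi
        (μ := fun j => Measure.pi fun i => gaussianReal (-(a j • x) i) 1)
        (f := fun j z => z + a j • x) (fun j => by fun_prop)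
      simp_rw [pi_gaussianReal_neg_map_add] at this
      exact this
  memLp_stat i := memLp_finsetSum _ fun j _ => (memLp_eval_eval j i).const_mul (a j)
  integral_stat := integral_sum_mul_eval a
  integral_stat_sq := integral_sum_mul_eval_sq a

end GaussianShiftInstances

namespace YChannel

section Combinatorics

variable {j k l : Fin 3}

theorem eq_or_eq_or_eq_of_distinct (hjk : j ≠ k) (hjl : j ≠ l) (hkl : k ≠ l) (x : Fin 3) :
    x = j ∨ x = k ∨ x = l := by
  omega

@[to_additive]
theorem prod_univ_of_distinct {M : Type*} [CommMonoid M] (hjk : j ≠ k) (hjl : j ≠ l) (hkl : k ≠ l)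
    (f : Fin 3 → M) : ∏ x, f x = f j * f k * f l := by
  have : (Finset.univ : Finset (Fin 3)) = {j, k, l} := by
    ext x
    simpa using eq_or_eq_or_eq_of_distinct hjk hjl hkl x
  rw [this, Finset.prod_insert (by simp [hjk, hjl]), Finset.prod_pair hkl, mul_assoc]

theorem eq_or_eq_of_ne (hjk : j ≠ k) (hjl : j ≠ l) (hkl : k ≠ l) (x : {x : Fin 3 // x ≠ j}) :
    x = ⟨k, hjk.symm⟩ ∨ x = ⟨l, hjl.symm⟩ := by
  obtain ⟨x, hx⟩ := x
  rcases eq_or_eq_or_eq_of_distinct hjk hjl hkl x with h | h | h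
  · exact absurd h hx
  · exact Or.inl (Subtype.ext h)
  · exact Or.inr (Subtype.ext h)

@[to_additive]
theorem prod_ne_of_distinct {M : Type*} [CommMonoid M] (hjk : j ≠ k) (hjl : j ≠ l) (hkl : k ≠ l)
    (f : {x : Fin 3 // x ≠ j} → M) : ∏ x, f x = f ⟨k, hjk.symm⟩ * f ⟨l, hjl.symm⟩ :=
  Fintype.prod_eq_mul _ _ (by simpa using hkl)
    fun x hx => ((eq_or_eq_of_ne hjk hjl hkl x).elim hx.1 hx.2).elim

variable {R : RateTuple} {n : ℕ}

/-- The product of the numbers of messages from `k` to `j`, from `l` to `j` and from `k` to `l`. -/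
noncomputable def tripleCount (R : RateTuple) (n : ℕ) (hjk : j ≠ k) (hjl : j ≠ l) (hkl : k ≠ l) : ℕ :=
  msgCount n (R k ⟨j, hjk⟩) * msgCount n (R l ⟨j, hjl⟩) * msgCount n (R k ⟨l, hkl.symm⟩)

theorem card_messages (hjk : j ≠ k) (hjl : j ≠ l) (hkl : k ≠ l) :
    Fintype.card (Messages R n)
      = Fintype.card (Own R n j × Fin (msgCount n (R l ⟨k, hkl⟩)))
        * tripleCount R n hjk hjl hkl := by
  rw [Fintype.card_prod, Fintype.card_pi, prod_univ_of_distinct hjk hjl hkl]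
  simp only [Fintype.card_pi, Fintype.card_fin, tripleCount]
  rw [prod_ne_of_distinct hjk.symm hkl hjl, prod_ne_of_distinct hjl.symm hkl.symm hjk]
  ring

theorem messages_eq_of_decoded (c : Code R n) (hjk : j ≠ k) (hjl : j ≠ l) (hkl : k ≠ l)
    {m m' : Messages R n} {yj yl : Fin n → ℝ}
    (hmj : c.dec j yj (m j) = wanted m j) (hml : c.dec l yl (m l) = wanted m l)
    (hmj' : c.dec j yj (m' j) = wanted m' j) (hml' : c.dec l yl (m' l) = wanted m' l)
    (hj : m j = m' j) (hlk : m l ⟨k, hkl⟩ = m' l ⟨k, hkl⟩) : m = m' := by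
  have wj : wanted m j = wanted m' j := by rw [← hmj, ← hmj', hj]
  have kj : m k ⟨j, hjk⟩ = m' k ⟨j, hjk⟩ := congrFun wj ⟨k, hjk.symm⟩
  have lj : m l ⟨j, hjl⟩ = m' l ⟨j, hjl⟩ := congrFun wj ⟨l, hjl.symm⟩
  have hl : m l = m' l := by
    funext x
    rcases eq_or_eq_of_ne hjl.symm hkl.symm hjk x with rfl | rfl
    exacts [lj, hlk]
  have wl : wanted m l = wanted m' l := by rw [← hml, ← hml', hl]
  have kl : m k ⟨l, hkl.symm⟩ = m' k ⟨l, hkl.symm⟩ := congrFun wl ⟨k, hkl⟩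
  have hk : m k = m' k := by
    funext x
    rcases eq_or_eq_of_ne hjk.symm hkl hjl x with rfl | rfl
    exacts [kj, kl]
  funext x
  rcases eq_or_eq_or_eq_of_distinct hjk hjl hkl x with rfl | rfl | rfl
  exacts [hj, hk, hl]

theorem one_le_msgCount (n : ℕ) {r : ℝ} (hr : 0 ≤ r) : 1 ≤ msgCount n r :=
  Nat.le_floor (by simpa using Real.one_le_rpow one_le_two (by positivity))

theorem nonempty_messages (hR : ∀ a b, 0 ≤ R a b) : Nonempty (Messages R n) :=
  ⟨fun a b => ⟨0, one_le_msgCount n (hR a b)⟩⟩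

theorem one_le_tripleCount (hR : ∀ a b, 0 ≤ R a b) (hjk : j ≠ k) (hjl : j ≠ l) (hkl : k ≠ l) :
    1 ≤ tripleCount R n hjk hjl hkl :=
  Nat.mul_pos (Nat.mul_pos (one_le_msgCount n (hR _ _)) (one_le_msgCount n (hR _ _)))
    (one_le_msgCount n (hR _ _))

theorem uniformOn_decoded_le (hR : ∀ a b, 0 ≤ R a b) (c : Code R n) (hjk : j ≠ k) (hjl : j ≠ l)
    (hkl : k ≠ l) (yj yl : Own R n j → Fin n → ℝ) :
    uniformOn (Set.univ : Set (Messages R n))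
        {m | c.dec j (yj (m j)) (m j) = wanted m j ∧ c.dec l (yl (m j)) (m l) = wanted m l}
      ≤ ENNReal.ofReal (1 / tripleCount R n hjk hjl hkl) := by
  set B := {m : Messages R n |
    c.dec j (yj (m j)) (m j) = wanted m j ∧ c.dec l (yl (m j)) (m l) = wanted m l}
  have hK := one_le_tripleCount (n := n) hR hjk hjl hkl
  have hcard : B.ncard ≤ Fintype.card (Own R n j × Fin (msgCount n (R l ⟨k, hkl⟩))) := by
    rw [← Nat.card_eq_fintype_card, ← Set.ncard_univ]
    refine Set.ncard_le_ncard_of_injOn (fun m => (m j, m l ⟨k, hkl⟩)) (fun _ _ => Set.mem_univ _) ?_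
    intro m hm m' hm' hmm
    obtain ⟨hj, hlk⟩ := Prod.mk.inj hmm
    exact messages_eq_of_decoded c hjk hjl hkl hm.1 hm.2 (by rw [hj]; exact hm'.1)
      (by rw [hj]; exact hm'.2) hj hlk
  rw [uniformOn_univ, Measure.count_apply_finite B B.toFinite, ← Set.ncard_eq_toFinset_card B]
  have hpos : 0 < Fintype.card (Messages R n) := by
    have := nonempty_messages (n := n) hR
    exact Fintype.card_pos
  rw [← ENNReal.ofReal_natCast, ← ENNReal.ofReal_natCast,
    ← ENNReal.ofReal_div_of_pos (by exact_mod_cast hpos)]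
  apply ENNReal.ofReal_le_ofReal
  rw [div_le_div_iff₀ (by exact_mod_cast hpos) (by exact_mod_cast hK), one_mul,
    card_messages hjk hjl hkl]
  exact_mod_cast Nat.mul_le_mul_right _ hcard

end Combinatorics

section Probability

variable {R : RateTuple} {n : ℕ}

theorem uniformOn_messages_eq_pi (R : RateTuple) (n : ℕ) :
    uniformOn (Set.univ : Set (Messages R n))
      = Measure.pi fun a => uniformOn (Set.univ : Set (Own R n a)) := by
  refine Measure.ext_of_singleton fun m => ?_
  rw [Measure.pi_singleton]
  simp only [uniformOn_univ, Measure.count_singleton, one_div, Fintype.card_pi, Nat.cast_prod]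
  rw [ENNReal.prod_inv_distrib]
  intro a _ b _ _
  exact Or.inr (ENNReal.prod_ne_top fun _ _ => ENNReal.natCast_ne_top _)

theorem integral_mul_messages (hR : ∀ a b, 0 ≤ R a b) {k l : Fin 3} (hkl : k ≠ l)
    (f : Own R n k → ℝ) (g : Own R n l → ℝ) :
    ∫ m, f (m k) * g (m l) ∂uniformOn (Set.univ : Set (Messages R n))
      = (∫ m, f (m k) ∂uniformOn (Set.univ : Set (Messages R n)))
        * ∫ m, g (m l) ∂uniformOn (Set.univ : Set (Messages R n)) := by
  have : ∀ a, IsProbabilityMeasure (uniformOn (Set.univ : Set (Own R n a))) := by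
    intro a
    have : Nonempty (Own R n a) := ⟨fun b => ⟨0, one_le_msgCount n (hR a b)⟩⟩
    infer_instance
  rw [uniformOn_messages_eq_pi]
  have hind : iIndepFun (fun a (m : Messages R n) => m a)
      (Measure.pi fun a => uniformOn (Set.univ : Set (Own R n a))) :=
    iIndepFun_pi (X := fun _ x => x) fun a => aemeasurable_id
  exact ((hind.indepFun hkl).comp (measurable_of_finite f)
    (measurable_of_finite g)).integral_fun_mul_eq_mul_integral
    (measurable_of_finite _).aestronglyMeasurable (measurable_of_finite _).aestronglyMeasurable

theorem isProbabilityMeasure_messages (hR : ∀ a b, 0 ≤ R a b) :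
    IsProbabilityMeasure (uniformOn (Set.univ : Set (Messages R n))) := by
  have := nonempty_messages (n := n) hR
  infer_instance

theorem prod_le_of_slices {M U : Type*} [MeasurableSpace M] [MeasurableSpace U] {μ : Measure M}
    {ν : Measure U} [IsProbabilityMeasure μ] [IsProbabilityMeasure ν] {E : Set (M × U)}
    (hE : MeasurableSet E) {b : ENNReal} (h : ∀ u, μ {m | (m, u) ∈ E} ≤ b) : μ.prod ν E ≤ b := by
  rw [Measure.prod_apply_symm hE]
  calc _ ≤ ∫⁻ _, b ∂ν := lintegral_mono fun u => h u
    _ = b := by simp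

theorem measurableSet_of_finite_slices {M W : Type*} [MeasurableSpace M] [Finite M]
    [MeasurableSingletonClass M] [MeasurableSpace W] {π : W → M} (hπ : Measurable π)
    {Q : M → W → Prop} (hQ : ∀ m, MeasurableSet {w | Q m w}) : MeasurableSet {w | Q (π w) w} := by
  have : {w | Q (π w) w} = ⋃ m, π ⁻¹' {m} ∩ {w | Q m w} := by
    ext w
    simp
  rw [this]
  exact MeasurableSet.iUnion fun m => (hπ (measurableSet_singleton m)).inter (hQ m)

theorem measurePreserving_fst_law (hR : ∀ a b, 0 ≤ R a b) :
    MeasurePreserving Prod.fst (law R n) (uniformOn (Set.univ : Set (Messages R n))) := by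
  have := isProbabilityMeasure_messages (n := n) hR
  exact measurePreserving_fst

theorem measurePreserving_relayNoise_userNoise (hR : ∀ a b, 0 ≤ R a b) :
    MeasurePreserving (fun ω : Outcome R n => ((ω.1, ω.2.1), ω.2.2)) (law R n)
      (((uniformOn (Set.univ : Set (Messages R n))).prod (stdGaussianPi (Fin n))).prod
        (Measure.pi fun _ : Fin 3 => stdGaussianPi (Fin n))) := by
  have := isProbabilityMeasure_messages (n := n) hR
  exact (measurePreserving_prodAssoc _ _ _).symm

theorem measurePreserving_userNoise_relayNoise (hR : ∀ a b, 0 ≤ R a b) :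
    MeasurePreserving (fun ω : Outcome R n => ((ω.1, ω.2.2), ω.2.1)) (law R n)
      (((uniformOn (Set.univ : Set (Messages R n))).prod
        (Measure.pi fun _ : Fin 3 => stdGaussianPi (Fin n))).prod (stdGaussianPi (Fin n))) := by
  have := isProbabilityMeasure_messages (n := n) hR
  exact (measurePreserving_prodAssoc _ _ _).symm.comp
    ((MeasurePreserving.id _).prod Measure.measurePreserving_swap)

theorem PowerConstraint.sum_integral_le {P : ℝ} {X : Fin n → Outcome R n → ℝ}
    (hX : PowerConstraint P X) (hn : 0 < n) : ∑ i, ∫ ω, X i ω ^ 2 ∂law R n ≤ n * P := by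
  have h := hX.2
  have hn' : (0 : ℝ) < n := by exact_mod_cast hn
  rwa [one_div, inv_mul_le_iff₀ hn'] at h

theorem one_sub_errorProb_le (hR : ∀ a b, 0 ≤ R a b) (c : Code R n) (h : Fin 3 → ℝ)
    {T : Type*} [MeasurableSpace T] {μ : Measure T} [IsProbabilityMeasure μ] {φ : Outcome R n → T}
    (hφ : MeasurePreserving φ (law R n) μ) {A : Set T} (hA : MeasurableSet A)
    (hsub : ∀ ω, ω ∉ c.errorEvent h → φ ω ∈ A) : 1 - c.errorProb h ≤ μ.real A := by
  have := isProbabilityMeasure_messages (n := n) hR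
  have : IsProbabilityMeasure (law R n) := by unfold law; infer_instance
  rw [measureReal_def, ← hφ.measure_preimage hA.nullMeasurableSet, ← measureReal_def,
    Code.errorProb, sub_le_iff_le_add, ← probReal_univ (μ := law R n)]
  refine (measureReal_mono fun ω _ => ?_).trans (measureReal_union_le _ _)
  by_cases hω : ω ∈ c.errorEvent h
  exacts [Or.inr hω, Or.inl (hsub ω hω)]

end Probability

end YChannel

namespace YChannel

section FiniteBlocklength

variable {R : RateTuple} {n : ℕ} {j k l : Fin 3}

/-- The power of a sum of two independent signals, the first of which is centred, is at most the
sum of the powers. -/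
theorem integral_sq_superposition_le (hR : ∀ a b, 0 ≤ R a b) (hkl : k ≠ l) (u v : ℝ)
    (f : Own R n k → ℝ) (g : Own R n l → ℝ) (μ : Measure (Messages R n))
    (hμ : μ = uniformOn Set.univ) :
    ∫ m, (u * (f (m k) - ∫ m, f (m k) ∂μ) + v * g (m l)) ^ 2 ∂μ
      ≤ u ^ 2 * ∫ m, f (m k) ^ 2 ∂μ + v ^ 2 * ∫ m, g (m l) ^ 2 ∂μ := by
  have : IsProbabilityMeasure μ := by rw [hμ]; exact isProbabilityMeasure_messages hR
  have hint : ∀ F : Messages R n → ℝ, Integrable F μ := fun F => Integrable.of_finite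
  set e := ∫ m, f (m k) ∂μ with he
  have hcross : ∫ m, (f (m k) - e) * g (m l) ∂μ = 0 := by
    rw [hμ, integral_mul_messages hR hkl (fun t => f t - e) g, ← hμ,
      integral_sub (hint _) (hint _)]
    simp [← he]
  have expand : ∀ m : Messages R n, (u * (f (m k) - e) + v * g (m l)) ^ 2
      = (u ^ 2 * f (m k) ^ 2 + v ^ 2 * g (m l) ^ 2)
        + (2 * u * v * ((f (m k) - e) * g (m l)) + (u ^ 2 * e ^ 2 - 2 * u ^ 2 * e * f (m k))) := by
    intro m; ring
  simp_rw [expand]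
  rw [integral_add (hint _) (hint _), integral_add (hint _) (hint _),
    integral_add (hint _) (hint _), integral_sub (hint _) (hint _)]
  simp only [integral_const_mul, integral_const, probReal_univ, smul_eq_mul, one_mul, hcross,
    ← he]
  nlinarith [sq_nonneg (u * e)]

/-- Bound at the relay: the relay decodes a message triple from a superposition of two
independent codewords. -/
theorem uplink_bound (hR : ∀ a b, 0 ≤ R a b) (c : Code R n) (h : Fin 3 → ℝ) {P : ℝ} (hP : 0 ≤ P)
    (hc : c.IsAdmissible h P) (hn : 0 < n) (hjk : j ≠ k) (hjl : j ≠ l) (hkl : k ≠ l) :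
    (1 - c.errorProb h) * Real.log (tripleCount R n hjk hjl hkl)
      ≤ n * (1 / 2 * Real.log (1 + (h k ^ 2 + h l ^ 2) * P)) + Real.log 2 := by
  have := isProbabilityMeasure_messages (n := n) hR
  set μ := uniformOn (Set.univ : Set (Messages R n)) with hμ
  set ν := Measure.pi fun _ : Fin 3 => stdGaussianPi (Fin n)
  set e : Fin n → ℝ := fun i => ∫ m : Messages R n, c.enc k (m k) i ∂μ
  set x : Messages R n → Fin n → ℝ :=
    fun m i => h k * (c.enc k (m k) i - e i) + h l * c.enc l (m l) i with hx
  set X : Messages R n × (Fin 3 → Fin n → ℝ) → Fin n → ℝ := fun p => x p.1 with hXdef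
  set r : Own R n j → (Fin n → ℝ) → Fin n → ℝ := fun mj y i =>
    c.relay i fun t => y (Fin.castLE i.isLt.le t)
      + (h j * c.enc j mj (Fin.castLE i.isLt.le t) + h k * e (Fin.castLE i.isLt.le t)) with hr
  have hrm : ∀ mj, Measurable (r mj) := by
    intro mj
    refine measurable_pi_lambda _ fun i => (c.measurable_relay i).comp ?_
    fun_prop
  set Q : Messages R n → (Messages R n × (Fin 3 → Fin n → ℝ)) × (Fin n → ℝ) → Prop := fun m p =>
    c.dec j (fun i => h j * r (m j) p.2 i + p.1.2 j i) (m j) = wanted m j ∧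
      c.dec l (fun i => h l * r (m j) p.2 i + p.1.2 l i) (m l) = wanted m l
  set D : Set ((Messages R n × (Fin 3 → Fin n → ℝ)) × (Fin n → ℝ)) := {p | Q p.1.1 p}
  have hDm : MeasurableSet D := by
    refine measurableSet_of_finite_slices (measurable_fst.comp measurable_fst) fun m => ?_
    have hdec : ∀ a : Fin 3, Measurable fun p : (Messages R n × (Fin 3 → Fin n → ℝ)) ×
        (Fin n → ℝ) => c.dec a (fun i => h a * r (m j) p.2 i + p.1.2 a i) (m a) := by
      intro a
      have hr' : ∀ i, Measurable fun y => r (m j) y i :=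
        fun i => (measurable_pi_apply i).comp (hrm (m j))
      refine (c.measurable_dec a (m a)).comp ?_
      fun_prop
    exact (hdec j (measurableSet_singleton _)).inter (hdec l (measurableSet_singleton _))
  have hXm : Measurable X := (measurable_of_finite x).comp measurable_fst
  have hXint : ∀ i, Integrable (fun p => X p i ^ 2) (μ.prod ν) := fun i =>
    (Integrable.of_finite (f := fun m => x m i ^ 2)).comp_fst ν
  have hpow : ∀ a i, ∫ ω, c.userSignal a i ω ^ 2 ∂law R n
      = ∫ m : Messages R n, c.enc a (m a) i ^ 2 ∂μ := by
    intro a i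
    rw [hμ, ← (measurePreserving_fst_law (n := n) hR).map_eq,
      integral_map measurable_fst.aemeasurable (measurable_of_finite _).aestronglyMeasurable]
    rfl
  have hXP : ∑ i, ∫ p, X p i ^ 2 ∂(μ.prod ν)
      ≤ n * (NNReal.mk ((h k ^ 2 + h l ^ 2) * P) (by positivity) : ℝ) := by
    have hi : ∀ i, ∫ p, X p i ^ 2 ∂(μ.prod ν)
        ≤ h k ^ 2 * ∫ ω, c.userSignal k i ω ^ 2 ∂law R n
          + h l ^ 2 * ∫ ω, c.userSignal l i ω ^ 2 ∂law R n := by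
      intro i
      rw [hpow, hpow, integral_fun_fst (fun m => x m i ^ 2)]
      simpa using integral_sq_superposition_le hR hkl (h k) (h l) (fun t => c.enc k t i)
        (fun t => c.enc l t i) μ hμ
    refine (Finset.sum_le_sum fun i _ => hi i).trans ?_
    rw [Finset.sum_add_distrib, ← Finset.mul_sum, ← Finset.mul_sum, NNReal.coe_mk]
    have hk := mul_le_mul_of_nonneg_left ((hc.1 k).sum_integral_le hn) (sq_nonneg (h k))
    have hl := mul_le_mul_of_nonneg_left ((hc.1 l).sum_integral_le hn) (sq_nonneg (h l))
    linarith
  have hslice : ∀ y, (μ.prod ν) {p | (p, y) ∈ D}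
      ≤ ENNReal.ofReal (1 / tripleCount R n hjk hjl hkl) := fun y =>
    prod_le_of_slices (measurable_prodMk_right hDm) fun z =>
      uniformOn_decoded_le hR c hjk hjl hkl (fun mj i => h j * r mj y i + z j i)
        (fun mj i => h l * r mj y i + z l i)
  have hK : (1 : ℝ) ≤ tripleCount R n hjk hjl hkl := by
    exact_mod_cast one_le_tripleCount hR hjk hjl hkl
  have key := (GaussianShift.single n).measureReal_mul_log_le zero_le_one _ hXm hXint hXP hDm hK
    hslice
  rw [NNReal.coe_mk, one_mul] at key
  refine (mul_le_mul_of_nonneg_right ?_ (Real.log_nonneg hK)).trans key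
  refine one_sub_errorProb_le hR c h (measurePreserving_userNoise_relayNoise hR) ?_ ?_
  · exact (measurable_fst.prodMk ((GaussianShift.single n).measurable_shift.comp
      ((hXm.comp measurable_fst).prodMk measurable_snd))) hDm
  · intro ω hω
    simp only [Code.errorEvent, Set.mem_ofPred_eq, not_exists, not_not] at hω
    have hrel : ∀ i, r (ω.1 j) ((GaussianShift.single n).shift (X (ω.1, ω.2.2)) ω.2.1) i
        = c.relaySignal h i ω := by
      intro i
      simp only [hr, Code.relaySignal]
      congr 1
      funext t
      have hsum : ∀ F : Fin 3 → ℝ, ∑ a, F a = F j + F k + F l := fun F =>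
        sum_univ_of_distinct hjk hjl hkl F
      rw [Code.relayReceived, hsum]
      simp only [GaussianShift.single, hXdef, hx, Pi.add_apply, Code.userSignal]
      ring
    refine ⟨?_, ?_⟩
    · simp only [hrel]
      exact hω j
    · simp only [hrel]
      exact hω l

/-- Bound at the users: two cooperating users decode a message triple from the relay's signal. -/
theorem downlink_bound (hR : ∀ a b, 0 ≤ R a b) (c : Code R n) (h : Fin 3 → ℝ) {P : ℝ}
    (hP : 0 ≤ P) (hc : c.IsAdmissible h P) (hn : 0 < n) (hjk : j ≠ k) (hjl : j ≠ l) (hkl : k ≠ l) :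
    (1 - c.errorProb h) * Real.log (tripleCount R n hjk hjl hkl)
      ≤ n * (1 / 2 * Real.log (1 + (h j ^ 2 + h l ^ 2) * P)) + Real.log 2 := by
  have := isProbabilityMeasure_messages (n := n) hR
  set μ := uniformOn (Set.univ : Set (Messages R n))
  set ν := stdGaussianPi (Fin n)
  set X : Messages R n × (Fin n → ℝ) → Fin n → ℝ :=
    fun p i => c.relaySignal h i (p.1, p.2, 0)
  set Q : Messages R n → (Messages R n × (Fin n → ℝ)) × (Fin 3 → Fin n → ℝ) → Prop := fun m p =>
    c.dec j (p.2 j) (m j) = wanted m j ∧ c.dec l (p.2 l) (m l) = wanted m l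
  set D : Set ((Messages R n × (Fin n → ℝ)) × (Fin 3 → Fin n → ℝ)) := {p | Q p.1.1 p}
  have hDm : MeasurableSet D := by
    refine measurableSet_of_finite_slices (measurable_fst.comp measurable_fst) fun m => ?_
    have hdec : ∀ a : Fin 3, Measurable fun p : (Messages R n × (Fin n → ℝ)) ×
        (Fin 3 → Fin n → ℝ) => c.dec a (p.2 a) (m a) := fun a =>
      (c.measurable_dec a (m a)).comp (by fun_prop)
    exact (hdec j (measurableSet_singleton _)).inter (hdec l (measurableSet_singleton _))
  have hXm : Measurable X := by
    refine measurable_pi_lambda _ fun i => (c.measurable_relay i).comp ?_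
    refine measurable_pi_lambda _ fun t => Measurable.add ?_ (by fun_prop)
    exact (measurable_of_finite fun m : Messages R n =>
      ∑ a, h a * c.enc a (m a) (Fin.castLE i.isLt.le t)).comp measurable_fst
  have hπ : MeasurePreserving (fun ω : Outcome R n => (ω.1, ω.2.1)) (law R n) (μ.prod ν) :=
    measurePreserving_fst.comp (measurePreserving_relayNoise_userNoise hR)
  have hXsq : ∀ i, Measurable fun p => X p i ^ 2 := fun i =>
    ((measurable_pi_apply i).comp hXm).pow_const 2
  have hXint : ∀ i, Integrable (fun p => X p i ^ 2) (μ.prod ν) := fun i =>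
    (hπ.integrable_comp (hXsq i).aestronglyMeasurable).1 (hc.2.1 i)
  have hXP : ∑ i, ∫ p, X p i ^ 2 ∂(μ.prod ν) ≤ n * (NNReal.mk P hP : ℝ) := by
    refine le_of_eq_of_le (Finset.sum_congr rfl fun i _ => ?_) (hc.2.sum_integral_le hn)
    rw [← hπ.map_eq, integral_map hπ.measurable.aemeasurable (hXsq i).aestronglyMeasurable]
    rfl
  have hslice : ∀ y, (μ.prod ν) {p | (p, y) ∈ D}
      ≤ ENNReal.ofReal (1 / tripleCount R n hjk hjl hkl) := fun y =>
    prod_le_of_slices (measurable_prodMk_right hDm) fun _ =>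
      uniformOn_decoded_le hR c hjk hjl hkl (fun _ => y j) (fun _ => y l)
  have hK : (1 : ℝ) ≤ tripleCount R n hjk hjl hkl := by
    exact_mod_cast one_le_tripleCount hR hjk hjl hkl
  set g : Fin 3 → ℝ := Function.update h k 0 with hg
  have hgj : g j = h j := Function.update_of_ne hjk _ _
  have hgl : g l = h l := Function.update_of_ne hkl.symm _ _
  have hsum : ∑ a, g a ^ 2 = h j ^ 2 + h l ^ 2 := by
    rw [sum_univ_of_distinct hjk hjl hkl, hgj, hgl, hg, Function.update_self]
    ring
  have key := (GaussianShift.multi n g).measureReal_mul_log_le (by rw [hsum]; positivity) _ hXm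
    hXint hXP hDm hK hslice
  rw [NNReal.coe_mk] at key
  rw [← hsum]
  refine (mul_le_mul_of_nonneg_right ?_ (Real.log_nonneg hK)).trans key
  refine one_sub_errorProb_le hR c h (measurePreserving_relayNoise_userNoise hR) ?_ ?_
  · exact (measurable_fst.prodMk ((GaussianShift.multi n g).measurable_shift.comp
      ((hXm.comp measurable_fst).prodMk measurable_snd))) hDm
  · intro ω hω
    simp only [Code.errorEvent, Set.mem_ofPred_eq, not_exists, not_not] at hω
    have hout : ∀ a, g a = h a →
        (GaussianShift.multi n g).shift (X (ω.1, ω.2.1)) ω.2.2 a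
          = fun i => c.userReceived h a i ω := by
      intro a ha
      funext i
      simp only [GaussianShift.multi, Pi.add_apply, Pi.smul_apply, smul_eq_mul, ha]
      exact add_comm _ _
    refine ⟨?_, ?_⟩
    · simp only [hout j hgj]
      exact hω j
    · simp only [hout l hgl]
      exact hω l

end FiniteBlocklength

section Asymptotics

theorem sub_one_mul_log_two_le_log_msgCount (n : ℕ) {r : ℝ} (hr : 0 ≤ r) :
    (n * r - 1) * Real.log 2 ≤ Real.log (msgCount n r) := by
  have h1 : (1 : ℝ) ≤ msgCount n r := by exact_mod_cast one_le_msgCount n hr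
  have h2 : (2 : ℝ) ^ ((n : ℝ) * r) ≤ 2 * msgCount n r := by
    have := (Nat.lt_floor_add_one ((2 : ℝ) ^ ((n : ℝ) * r))).le
    rw [← msgCount] at this
    linarith
  have h3 := Real.log_le_log (by positivity) h2
  rw [Real.log_rpow two_pos, Real.log_mul two_ne_zero (by positivity)] at h3
  linarith

variable {R : RateTuple} {j k l : Fin 3}

theorem triple_le_gaussCap (hR : ∀ a b, 0 ≤ R a b) (hjk : j ≠ k) (hjl : j ≠ l) (hkl : k ≠ l)
    {ε : ℕ → ℝ} (hε : Tendsto ε atTop (𝓝 0)) {x : ℝ}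
    (hbound : ∀ n, 0 < n → (1 - ε n) * Real.log (tripleCount R n hjk hjl hkl)
      ≤ n * (1 / 2 * Real.log (1 + x)) + Real.log 2) :
    R k ⟨j, hjk⟩ + R l ⟨j, hjl⟩ + R k ⟨l, hkl.symm⟩ ≤ gaussCap x := by
  set s := R k ⟨j, hjk⟩ + R l ⟨j, hjl⟩ + R k ⟨l, hkl.symm⟩ with hs
  have hlog2 : 0 < Real.log 2 := Real.log_pos one_lt_two
  have hlog : ∀ n : ℕ, (n * s - 3) * Real.log 2 ≤ Real.log (tripleCount R n hjk hjl hkl) := by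
    intro n
    have h0 : ∀ a b, (msgCount n (R a b) : ℝ) ≠ 0 := fun a b => by
      exact_mod_cast Nat.one_le_iff_ne_zero.1 (one_le_msgCount n (hR a b))
    rw [tripleCount, Nat.cast_mul, Nat.cast_mul,
      Real.log_mul (mul_ne_zero (h0 _ _) (h0 _ _)) (h0 _ _), Real.log_mul (h0 _ _) (h0 _ _)]
    have h1 := sub_one_mul_log_two_le_log_msgCount n (hR k ⟨j, hjk⟩)
    have h2 := sub_one_mul_log_two_le_log_msgCount n (hR l ⟨j, hjl⟩)
    have h3 := sub_one_mul_log_two_le_log_msgCount n (hR k ⟨l, hkl.symm⟩)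
    rw [hs]
    linarith
  have hinv : Tendsto (fun n : ℕ => (1 : ℝ) / n) atTop (𝓝 0) := tendsto_one_div_atTop_nhds_zero_nat
  have hleft : Tendsto (fun n : ℕ => (1 - ε n) * (s - 3 * (1 / (n : ℝ)))) atTop
      (𝓝 ((1 - 0) * (s - 3 * 0))) :=
    (hε.const_sub 1).mul ((hinv.const_mul 3).const_sub s)
  have hright : Tendsto (fun n : ℕ => gaussCap x + 1 / (n : ℝ)) atTop (𝓝 (gaussCap x + 0)) :=
    hinv.const_add _
  have hev : ∀ᶠ n : ℕ in atTop, (1 - ε n) * (s - 3 * (1 / (n : ℝ))) ≤ gaussCap x + 1 / n := by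
    filter_upwards [eventually_gt_atTop 0, hε.eventually_lt_const one_pos] with n hn hεn
    have hn' : (0 : ℝ) < n := by exact_mod_cast hn
    have h1 := (mul_le_mul_of_nonneg_left (hlog n) (sub_nonneg.2 hεn.le)).trans (hbound n hn)
    have h2 : Real.log (1 + x) = 2 * gaussCap x * Real.log 2 := by
      rw [gaussCap, Real.logb]
      field_simp
    have h3 : ((1 - ε n) * (n * s - 3)) * Real.log 2 ≤ (n * gaussCap x + 1) * Real.log 2 := by
      rw [h2] at h1
      linarith
    have h4 := le_of_mul_le_mul_right h3 hlog2
    refine le_of_mul_le_mul_left ?_ hn'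
    calc (n : ℝ) * ((1 - ε n) * (s - 3 * (1 / n))) = (1 - ε n) * (n * s - 3) := by field_simp
      _ ≤ n * gaussCap x + 1 := h4
      _ = n * (gaussCap x + 1 / n) := by field_simp
  simpa using le_of_tendsto_of_tendsto hleft hright hev

theorem triple_le_of_mem_capacityRegion {h : Fin 3 → ℝ} {P : ℝ} (hP : 0 ≤ P)
    (hR : R ∈ capacityRegion h P) (hjk : j ≠ k) (hjl : j ≠ l) (hkl : k ≠ l) :
    R k ⟨j, hjk⟩ + R l ⟨j, hjl⟩ + R k ⟨l, hkl.symm⟩ ≤ gaussCap ((h k ^ 2 + h l ^ 2) * P) ∧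
      R k ⟨j, hjk⟩ + R l ⟨j, hjl⟩ + R k ⟨l, hkl.symm⟩ ≤ gaussCap ((h j ^ 2 + h l ^ 2) * P) := by
  obtain ⟨hpos, c, hc, herr⟩ := hR
  exact ⟨triple_le_gaussCap hpos hjk hjl hkl herr fun n hn =>
      uplink_bound hpos (c n) h hP (hc n) hn hjk hjl hkl,
    triple_le_gaussCap hpos hjk hjl hkl herr fun n hn =>
      downlink_bound hpos (c n) h hP (hc n) hn hjk hjl hkl⟩

theorem sumRate_eq (R : RateTuple) (hjk : j ≠ k) (hjl : j ≠ l) (hkl : k ≠ l) :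
    sumRate R = (R k ⟨j, hjk⟩ + R l ⟨j, hjl⟩ + R k ⟨l, hkl.symm⟩)
      + (R j ⟨k, hjk.symm⟩ + R l ⟨k, hkl⟩ + R j ⟨l, hjl.symm⟩) := by
  rw [sumRate, sum_univ_of_distinct hjk hjl hkl, sum_ne_of_distinct hjk hjl hkl,
    sum_ne_of_distinct hjk.symm hkl hjl, sum_ne_of_distinct hjl.symm hkl.symm hjk]
  ring

end Asymptotics

end YChannel

theorem mainTheorem6 (h : Fin 3 → ℝ) (P : ℝ) (hP : 0 ≤ P) :
    (∀ R ∈ YChannel.capacityRegion h P, ∀ (j k l : Fin 3) (hjk : j ≠ k) (hjl : j ≠ l) (hkl : k ≠ l),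
      R k ⟨j, hjk⟩ + R l ⟨j, hjl⟩ + R k ⟨l, hkl.symm⟩
          ≤ YChannel.gaussCap ((h k ^ 2 + h l ^ 2) * P) ∧
      R k ⟨j, hjk⟩ + R l ⟨j, hjl⟩ + R k ⟨l, hkl.symm⟩
          ≤ YChannel.gaussCap ((h j ^ 2 + h l ^ 2) * P)) ∧
    (h 1 ^ 2 ≤ h 0 ^ 2 → h 2 ^ 2 ≤ h 1 ^ 2 →
      YChannel.sumCapacity h P
        ≤ ((2 * YChannel.gaussCap ((h 1 ^ 2 + h 2 ^ 2) * P) : ℝ) : EReal)) := by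
  refine ⟨fun R hR j k l hjk hjl hkl =>
    YChannel.triple_le_of_mem_capacityRegion hP hR hjk hjl hkl, fun _ _ => ?_⟩
  refine iSup₂_le fun R hR => EReal.coe_le_coe_iff.2 ?_
  have h01 : (0 : Fin 3) ≠ 1 := by decide
  have h02 : (0 : Fin 3) ≠ 2 := by decide
  have h12 : (1 : Fin 3) ≠ 2 := by decide
  have hup := (YChannel.triple_le_of_mem_capacityRegion hP hR h01 h02 h12).1
  have hdown := (YChannel.triple_le_of_mem_capacityRegion hP hR h01.symm h12 h02).2
  rw [YChannel.sumRate_eq R h01 h02 h12]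
  linarith
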